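/- Let $\mathcal D$ be a category. Its suspension $\Sigma\mathcal D$ is the strict $2$-category with two objects $x,y$ and hom categories $\mathrm{Map}(x,y)=\mathcal D$, $\mathrm{Map}(y,x)=\varnothing$, $\mathrm{Map}(x,x)=\mathrm{Map}(y,y)=[0]$. Let $N\Sigma\mathcal D$ be its Duskin nerve: the $3$-coskeletal simplicial set whose $0$-, $1$- and $2$-simplices are the objects, the $1$-morphisms, and the $2$-cells $c\Rightarrow b\circ a$, and whose $3$-simplices are the commuting tetrahedra of such $2$-cells; equivalently, its $n$-simplices are the normal oplax functors $[n]\to\Sigma\mathcal D$. Let $n\ge 2$ and $0\le k\le n-1$, and let $\sigma$ be an $n$-simplex of $N\Sigma\mathcal D$ of type $k$, i.e. one whose edge $(k,k+1)$ is non-degenerate (so its vertices $0,\dots,k$ are $x$ and its vertices $k+1,\dots,n$ are $y$). The corresponding $\mathcal D$-valued matrix is the functor $M_\sigma\colon[k]\times[n-1-k]^{\mathrm{op}}\to\mathcal D$ whose entry at $(i,j)$ is the object of $\mathcal D$ given by the edge $(i,k+1+j)$ of $\sigma$, whose vertical morphism $(i,j)\to(i',j)$, for $i\le i'$, is the $2$-cell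 of the face $(i,i',k+1+j)$ of $\sigma$, and whose horizontal morphism $(i,j)\to(i,j')$, for $j'\le j$, is the $2$-cell of the face $(i,k+1+j',k+1+j)$ of $\sigma$. For a triangulation $\mathcal T$ of the convex $(n+1)$-gon with cyclically numbered vertices $0,\dots,n$ (all of whose triangles have vertices among those of the polygon), let $\Delta[\mathcal T]\subset\Delta[n]$ be the simplicial subset generated by the $2$-faces corresponding to the triangles of $\mathcal T$. A $\sigma$-labeled triangulation consists of such a $\mathcal T$ having no triangle with all its vertices in $\{0,\dots,k\}$ and no triangle with all its vertices in $\{k+1,\dots,n\}$, together with the composite $\Delta[\mathcal T]\hookrightarrow\Delta[n]\xrightarrow{\sigma}N\Sigma\mathcal D$. A monotone path inside $M_\sigma$ consists of a shuffle $S=(\alpha,\beta)\colon[n-1]\to[k]\times[n-1-k]^{\mathrm{op}}$ (a functor that is non-degenerate as an $(n-1)$-simplex of the nerve of $[k]\times[n-1-k]^{\mathrm{op}}$), together with the composite $P=M_\sigma\circ S\colon[n-1]\to\mathcal D$. Then there is a bijection between the $\sigma$-labeled triangulations $\Delta[\mathcal T]\to N\Sigma\mathcal D$ and the monotone paths $P\colon[n-1]\to\mathcal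 D$ inside $M_\sigma$. Moreover, the bijection can be chosen so that the triangles of $\mathcal T$ are exactly the sets $\{\alpha(t),\ \alpha(t+1),\ k+1+\beta(t+1),\ k+1+\beta(t)\}$ for $0\le t\le n-2$, where $S=(\alpha,\beta)$ is the shuffle of the corresponding path: vertical steps $(i,j)\to(i+1,j)$ of the path correspond to the triangles $\{i,i+1,k+1+j\}$, and horizontal steps $(i,j+1)\to(i,j)$ to the triangles $\{i,k+1+j,k+2+j\}$. -/

import Mathlib

open CategoryTheory Bicategory Opposite

universe w v u

/-- The objects `x` and `y` of the suspension 2-category `Σ D` of a category `D`. -/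
inductive Suspension (D : Type u) : Type
  | x : Suspension D
  | y : Suspension D

namespace Suspension

variable {D : Type u}

/-- The 1-morphisms of `Σ D`: `Map(x, y) = D`, `Map(y, x)` is empty, and `Map(x, x)`, `Map(y, y)` are
terminal. -/
def Hom : Suspension D → Suspension D → Type u
  | .x, .x => PUnit
  | .x, .y => D
  | .y, .x => PEmpty
  | .y, .y => PUnit

/-- The 2-morphisms of `Σ D`. -/
def Hom₂ [Category.{v} D] : ∀ {a b : Suspension D}, Hom a b → Hom a b → Type v
  | .x, .x, _, _ => PUnit
  | .x, .y, d, e => Quiver.Hom (V := D) d e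
  | .y, .x, _, _ => PEmpty
  | .y, .y, _, _ => PUnit

/-- The hom categories of `Σ D`. -/
instance homCategory [Category.{v} D] : ∀ a b : Suspension D, Category.{v} (Hom a b)
  | .x, .x => { Hom := Hom₂, id := fun _ => ⟨⟩, comp := fun _ _ => ⟨⟩ }
  | .x, .y => inferInstanceAs (Category.{v} D)
  | .y, .x => { Hom := Hom₂, id := fun f => f.elim, comp := fun {f} _ _ => f.elim,
                id_comp := fun {f} => f.elim, comp_id := fun {f} => f.elim,
                assoc := fun {f} => f.elim }
  | .y, .y => { Hom := Hom₂, id := fun _ => ⟨⟩, comp := fun _ _ => ⟨⟩ }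

/-- Identity 1-morphisms of `Σ D`. -/
def idHom : ∀ a : Suspension D, Hom a a
  | .x => ⟨⟩
  | .y => ⟨⟩

/-- Composition of 1-morphisms of `Σ D` (in diagrammatic order). -/
def compHom : ∀ {a b c : Suspension D}, Hom a b → Hom b c → Hom a c
  | .x, .x, .x, _, _ => ⟨⟩
  | .x, .x, .y, _, d => d
  | .x, .y, .x, _, e => e.elim
  | .x, .y, .y, d, _ => d
  | .y, .x, _, e, _ => e.elim
  | .y, .y, .x, _, e => e
  | .y, .y, .y, _, _ => ⟨⟩

instance instCategoryStruct : CategoryStruct (Suspension D) where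
  Hom := Hom
  id := idHom
  comp := compHom

/-- The hom category `Map(a, b)` of `Σ D`, as a category of morphisms `a ⟶ b`. -/
instance instCategoryHom [Category.{v} D] (a b : Suspension D) : Category.{v} (a ⟶ b) :=
  homCategory a b

lemma id_compHom : ∀ {a b : Suspension D} (f : Hom a b), compHom (idHom a) f = f
  | .x, .x, _ => rfl
  | .x, .y, _ => rfl
  | .y, .x, e => e.elim
  | .y, .y, _ => rfl

lemma assocHom {a b c d : Suspension D} (f : Hom a b) (g : Hom b c) (h : Hom c d) :
    compHom (compHom f g) h = compHom f (compHom g h) := by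
  cases a <;> cases b <;> first | exact PEmpty.elim f | skip
  all_goals cases c <;> first | exact PEmpty.elim g | skip
  all_goals cases d <;> first | exact PEmpty.elim h | rfl

lemma comp_idHom {a b : Suspension D} (f : Hom a b) : compHom f (idHom b) = f := by
  cases a <;> cases b <;> first | exact PEmpty.elim f | rfl

variable [Category.{v} D]

/-- Left whiskering in `Σ D`. -/
def whiskerL : ∀ {a b c : Suspension D} (f : Hom a b) {g h : Hom b c} (_ : g ⟶ h),
    compHom f g ⟶ compHom f h
  | .x, .x, .x, _, _, _, _ => 𝟙 _
  | .x, .x, .y, _, _, _, η => η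
  | .x, .y, .x, _, e, _, _ => e.elim
  | .x, .y, .y, _, _, _, _ => 𝟙 _
  | .y, .x, _, e, _, _, _ => e.elim
  | .y, .y, .x, _, e, _, _ => e.elim
  | .y, .y, .y, _, _, _, _ => 𝟙 _

/-- Right whiskering in `Σ D`. -/
def whiskerR : ∀ {a b c : Suspension D} {f g : Hom a b} (_ : f ⟶ g) (h : Hom b c),
    compHom f h ⟶ compHom g h
  | .x, .x, .x, _, _, _, _ => 𝟙 _
  | .x, .x, .y, _, _, _, _ => 𝟙 _
  | .x, .y, .x, _, _, _, e => e.elim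
  | .x, .y, .y, _, _, η, _ => η
  | .y, .x, _, e, _, _, _ => e.elim
  | .y, .y, .x, _, _, _, e => e.elim
  | .y, .y, .y, _, _, _, _ => 𝟙 _

lemma sandwich {a b : D} (η : a ⟶ b) : η = 𝟙 a ≫ η ≫ 𝟙 b := by simp

/-- The suspension `Σ D`; all its coherence 2-cells are identities. -/
instance instBicategory : Bicategory.{v, u} (Suspension D) where
  homCategory a b := homCategory a b
  whiskerLeft := whiskerL
  whiskerRight := whiskerR
  associator f g h := eqToIso (assocHom f g h)
  leftUnitor f := eqToIso (id_compHom f)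
  rightUnitor f := eqToIso (comp_idHom f)
  whiskerLeft_id {a b c} f g := by
    cases a <;> cases b <;> first | exact PEmpty.elim f | skip
    all_goals cases c <;> first | exact PEmpty.elim g | rfl
  whiskerLeft_comp {a b c} f g _ _ _ _ := by
    cases a <;> cases b <;> first | exact PEmpty.elim f | skip
    all_goals cases c <;> first | exact PEmpty.elim g | rfl | skip
    exact (Category.id_comp (obj := D) _).symm
  id_whiskerLeft {a b} f g η := by
    cases a <;> cases b <;> first | exact PEmpty.elim f | rfl | exact sandwich (D := D) _
  comp_whiskerLeft {a b c d} f g h _ _ := by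
    cases a <;> cases b <;> first | exact PEmpty.elim f | skip
    all_goals cases c <;> first | exact PEmpty.elim g | skip
    all_goals cases d <;> first | exact PEmpty.elim h | rfl | exact sandwich (D := D) _
  id_whiskerRight {a b c} f g := by
    cases a <;> cases b <;> first | exact PEmpty.elim f | skip
    all_goals cases c <;> first | exact PEmpty.elim g | rfl
  comp_whiskerRight {a b c} f _ _ _ _ g := by
    cases a <;> cases b <;> first | exact PEmpty.elim f | skip
    all_goals cases c <;> first | exact PEmpty.elim g | rfl | skip
    exact (Category.id_comp (obj := D) _).symm
  whiskerRight_id {a b} f g η := by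
    cases a <;> cases b <;> first | exact PEmpty.elim f | rfl | exact sandwich (D := D) _
  whiskerRight_comp {a b c d} f _ _ g h := by
    cases a <;> cases b <;> first | exact PEmpty.elim f | skip
    all_goals cases c <;> first | exact PEmpty.elim g | skip
    all_goals cases d <;> first | exact PEmpty.elim h | rfl | exact sandwich (D := D) _
  whisker_assoc {a b c d} f g _ _ h := by
    cases a <;> cases b <;> first | exact PEmpty.elim f | skip
    all_goals cases c <;> first | exact PEmpty.elim g | skip
    all_goals cases d <;> first | exact PEmpty.elim h | rfl | exact sandwich (D := D) _
  whisker_exchange {a b c} f _ g _ _ _ := by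
    cases a <;> cases b <;> first | exact PEmpty.elim f | skip
    all_goals cases c <;> first | exact PEmpty.elim g | rfl | skip
    · exact (Category.comp_id (obj := D) _).trans (Category.id_comp (obj := D) _).symm
    · exact (Category.id_comp (obj := D) _).trans (Category.comp_id (obj := D) _).symm
  pentagon {a b c d e} f g h i := by
    cases a <;> cases b <;> first | exact PEmpty.elim f | skip
    all_goals cases c <;> first | exact PEmpty.elim g | skip
    all_goals cases d <;> first | exact PEmpty.elim h | skip
    all_goals cases e <;> first | exact PEmpty.elim i | rfl | skip
    all_goals exact Category.id_comp (obj := D) _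
  triangle {a b c} f g := by
    cases a <;> cases b <;> first | exact PEmpty.elim f | skip
    all_goals cases c <;> first | exact PEmpty.elim g | rfl | skip
    all_goals exact Category.id_comp (obj := D) _

/-- `Σ D` is a strict 2-category. -/
instance instStrict : Bicategory.Strict (Suspension D) where
  id_comp := id_compHom
  comp_id := comp_idHom
  assoc := assocHom
end Suspension

namespace Suspension

variable {D : Type u} [Category.{v} D]

/-- The identification of the hom category `Map(a, b)` with `D`, for `a = x` and `b = y`. -/
def homFunctor : ∀ {a b : Suspension D}, a = .x → b = .y → ((a ⟶ b) ⥤ D)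
  | .x, .y, _, _ => Functor.id D

lemma homFunctor_comp_left {a b c : Suspension D} (ha : a = .x) (hb : b = .x) (hc : c = .y)
    (f : a ⟶ b) (g : b ⟶ c) :
    (homFunctor ha hc).obj (f ≫ g) = (homFunctor hb hc).obj g := by
  subst ha hb hc; rfl

lemma homFunctor_comp_right {a b c : Suspension D} (ha : a = .x) (hb : b = .y) (hc : c = .y)
    (f : a ⟶ b) (g : b ⟶ c) :
    (homFunctor ha hc).obj (f ≫ g) = (homFunctor ha hb).obj f := by
  subst ha hb hc; rfl

/-- A 2-cell `h ⟹ g ∘ f` with `f : x ⟶ x` and `g h : x ⟶ y` is a morphism `h ⟶ g` of `D`. -/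
def cellLeft {a b c : Suspension D} (ha : a = .x) (hb : b = .x) (hc : c = .y)
    {f : a ⟶ b} {g : b ⟶ c} {h : a ⟶ c} (η : h ⟶ f ≫ g) :
    (homFunctor ha hc).obj h ⟶ (homFunctor hb hc).obj g :=
  (homFunctor ha hc).map η ≫ eqToHom (homFunctor_comp_left ha hb hc f g)

/-- A 2-cell `h ⟹ g ∘ f` with `f h : x ⟶ y` and `g : y ⟶ y` is a morphism `h ⟶ f` of `D`. -/
def cellRight {a b c : Suspension D} (ha : a = .x) (hb : b = .y) (hc : c = .y)
    {f : a ⟶ b} {g : b ⟶ c} {h : a ⟶ c} (η : h ⟶ f ≫ g) :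
    (homFunctor ha hc).obj h ⟶ (homFunctor ha hb).obj f :=
  (homFunctor ha hc).map η ≫ eqToHom (homFunctor_comp_right ha hb hc f g)

lemma cellLeft_id {a b : Suspension D} (ha : a = .x) (hb : b = .y) {e : a ⟶ a} (he : e = 𝟙 a)
    {f : a ⟶ b} (η : f ⟶ e ≫ f) (h : η ≫ eqToHom he ▷ f ≫ (λ_ f).hom = 𝟙 f) :
    cellLeft ha ha hb η = 𝟙 _ := by
  subst ha hb he
  refine Eq.trans ?_ h
  refine congrArg (fun z => CategoryStruct.comp (obj := D) η z) ?_
  exact (Category.id_comp (obj := D) _).symm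

lemma cellRight_id {a b : Suspension D} (ha : a = .x) (hb : b = .y) {e : b ⟶ b} (he : e = 𝟙 b)
    {f : a ⟶ b} (η : f ⟶ f ≫ e) (h : η ≫ f ◁ eqToHom he ≫ (ρ_ f).hom = 𝟙 f) :
    cellRight ha hb hb η = 𝟙 _ := by
  subst ha hb he
  refine Eq.trans ?_ h
  refine congrArg (fun z => CategoryStruct.comp (obj := D) η z) ?_
  exact (Category.id_comp (obj := D) _).symm

lemma comp_aux₁ {p q r : D} {f : p ⟶ q} {g : q ⟶ r} {h : p ⟶ r}
    (e : f ≫ g = h ≫ 𝟙 r ≫ 𝟙 r) : (f ≫ 𝟙 q) ≫ g ≫ 𝟙 r = h ≫ 𝟙 r := by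
  simpa using e

lemma comp_aux₂ {p q r : D} {f : p ⟶ q} {g : q ⟶ r} {h : p ⟶ r}
    (e : h ≫ 𝟙 r = f ≫ g ≫ 𝟙 r) : (f ≫ 𝟙 q) ≫ g ≫ 𝟙 r = h ≫ 𝟙 r := by
  simpa using e.symm

lemma comp_aux₃ {p q q' r : D} {f : p ⟶ q} {g : q ⟶ r} {f' : p ⟶ q'} {g' : q' ⟶ r}
    (e : f ≫ g = f' ≫ g' ≫ 𝟙 r) :
    (f ≫ 𝟙 q) ≫ g ≫ 𝟙 r = (f' ≫ 𝟙 q') ≫ g' ≫ 𝟙 r := by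
  simpa using e

section

variable {a b c d : Suspension D} {ab : a ⟶ b} {bc : b ⟶ c} {cd : c ⟶ d} {ac : a ⟶ c}
  {bd : b ⟶ d} {ad : a ⟶ d} {abd : ad ⟶ ab ≫ bd} {bcd : bd ⟶ bc ≫ cd} {acd : ad ⟶ ac ≫ cd}
  {abc : ac ⟶ ab ≫ bc}

lemma cellLeft_comp (ha : a = .x) (hb : b = .x) (hc : c = .x) (hd : d = .y)
    (h : abd ≫ ab ◁ bcd = acd ≫ abc ▷ cd ≫ (α_ ab bc cd).hom) :
    cellLeft ha hb hd abd ≫ cellLeft hb hc hd bcd = cellLeft ha hc hd acd := by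
  subst ha hb hc hd
  exact comp_aux₁ (D := D) h

lemma cellRight_comp (ha : a = .x) (hb : b = .y) (hc : c = .y) (hd : d = .y)
    (h : abd ≫ ab ◁ bcd = acd ≫ abc ▷ cd ≫ (α_ ab bc cd).hom) :
    cellRight ha hc hd acd ≫ cellRight ha hb hc abc = cellRight ha hb hd abd := by
  subst ha hb hc hd
  exact comp_aux₂ (D := D) h

lemma cellLeft_cellRight (ha : a = .x) (hb : b = .x) (hc : c = .y) (hd : d = .y)
    (h : abd ≫ ab ◁ bcd = acd ≫ abc ▷ cd ≫ (α_ ab bc cd).hom) :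
    cellLeft ha hb hd abd ≫ cellRight hb hc hd bcd =
      cellRight ha hc hd acd ≫ cellLeft ha hb hc abc := by
  subst ha hb hc hd
  exact comp_aux₃ (D := D) h

end

end Suspension

/-- An `n`-simplex of the Duskin nerve of a 2-category `C`: objects indexed by the vertices,
1-morphisms indexed by the edges, a 2-cell `map (i, k) ⟹ map (j, k) ∘ map (i, j)` for every 2-face
`i ≤ j ≤ k` (`≫` is composition in diagrammatic order), subject to one relation for every 3-face and
to normalization on degenerate faces. In other words, a normal oplax functor `[n] ⥤ C`. Since all
data and relations live on faces of dimension at most 3, this is the 3-coskeletal simplicial set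
whose simplices of dimension at most 3 are the objects, the 1-morphisms, the 2-cells
`c ⟹ b ∘ a` and the commuting tetrahedra of such 2-cells. -/
structure DuskinSimplex (C : Type u) [Bicategory.{w, v} C] (n : ℕ) where
  obj : Fin (n + 1) → C
  map : ∀ {i j : Fin (n + 1)}, i ≤ j → (obj i ⟶ obj j)
  map_id : ∀ i : Fin (n + 1), map (le_refl i) = 𝟙 (obj i)
  cell : ∀ {i j k : Fin (n + 1)} (hij : i ≤ j) (hjk : j ≤ k),
    map (hij.trans hjk) ⟶ map hij ≫ map hjk
  cell_id_left : ∀ {i j : Fin (n + 1)} (h : i ≤ j),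
    cell (le_refl i) h ≫ eqToHom (map_id i) ▷ map h ≫ (λ_ (map h)).hom = 𝟙 (map h)
  cell_id_right : ∀ {i j : Fin (n + 1)} (h : i ≤ j),
    cell h (le_refl j) ≫ map h ◁ eqToHom (map_id j) ≫ (ρ_ (map h)).hom = 𝟙 (map h)
  cell_assoc : ∀ {i j k l : Fin (n + 1)} (hij : i ≤ j) (hjk : j ≤ k) (hkl : k ≤ l),
    cell hij (hjk.trans hkl) ≫ map hij ◁ cell hjk hkl =
      cell (hij.trans hjk) hkl ≫ cell hij hjk ▷ map hkl ≫
        (α_ (map hij) (map hjk) (map hkl)).hom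

/-- Restriction of a simplex of the Duskin nerve along a monotone map. -/
def DuskinSimplex.restrict {C : Type u} [Bicategory.{w, v} C] {m n : ℕ} (σ : DuskinSimplex C n)
    (θ : Fin (m + 1) →o Fin (n + 1)) : DuskinSimplex C m where
  obj i := σ.obj (θ i)
  map h := σ.map (θ.monotone h)
  map_id i := σ.map_id (θ i)
  cell hij hjk := σ.cell (θ.monotone hij) (θ.monotone hjk)
  cell_id_left h := σ.cell_id_left (θ.monotone h)
  cell_id_right h := σ.cell_id_right (θ.monotone h)
  cell_assoc hij hjk hkl := σ.cell_assoc (θ.monotone hij) (θ.monotone hjk) (θ.monotone hkl)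

/-- The Duskin nerve `N(C)` of a 2-category `C`. -/
def duskinNerve (C : Type u) [Bicategory.{w, v} C] : SSet.{max u v w} where
  obj m := DuskinSimplex C m.unop.len
  map f := ↾fun σ => σ.restrict f.unop.toOrderHom
  map_id _ := rfl
  map_comp _ _ := rfl

open Simplicial

section typeK

variable {D : Type u} [Category.{v} D] {n : ℕ}

/-- An `n`-simplex of `N(Σ D)` is of type `k`, for `0 ≤ k ≤ n - 1`, if its edge `(k, k+1)` is
non-degenerate. -/
def IsOfType (σ : (duskinNerve (Suspension D)) _⦋n⦌) (k : Fin n) : Prop :=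
  (duskinNerve (Suspension D)).map (SimplexCategory.mkOfSucc k).op σ ∈
    (duskinNerve (Suspension D)).nonDegenerate 1

/-- A simplex of `N(Σ D)` all of whose vertices are equal is determined by that vertex. -/
lemma DuskinSimplex.ext_of_const {σ τ : DuskinSimplex (Suspension D) n} {a : Suspension D}
    (hσ : ∀ i, σ.obj i = a) (hτ : ∀ i, τ.obj i = a) : σ = τ := by
  obtain ⟨o, m, mi, c, _, _, _⟩ := σ
  obtain ⟨o', m', mi', c', _, _, _⟩ := τ
  obtain rfl : o = fun _ => a := funext hσ
  obtain rfl : o' = fun _ => a := funext hτ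
  obtain rfl : @m = @m' := by
    cases a <;> (funext i j h; exact Subsingleton.elim (α := PUnit) _ _)
  obtain rfl : @c = @c' := by
    cases a <;> (funext i j k h h'; exact Subsingleton.elim (α := PUnit) _ _)
  rfl

lemma IsOfType.obj_castSucc_succ {σ : (duskinNerve (Suspension D)) _⦋n⦌} {k : Fin n}
    (h : IsOfType σ k) :
    DuskinSimplex.obj σ k.castSucc = .x ∧ DuskinSimplex.obj σ k.succ = .y := by
  have key : DuskinSimplex.obj σ k.castSucc ≠ DuskinSimplex.obj σ k.succ := by
    intro e
    refine h ⟨0, Nat.zero_lt_one, SimplexCategory.σ 0,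
      DuskinSimplex.restrict σ ⟨fun _ => k.castSucc, fun _ _ _ => le_rfl⟩, ?_⟩
    refine DuskinSimplex.ext_of_const (a := DuskinSimplex.obj σ k.castSucc) (fun _ => rfl) ?_
    intro i
    match i with
    | 0 => rfl
    | 1 => exact e.symm
  have f := DuskinSimplex.map σ (Fin.castSucc_le_succ k)
  revert f key
  generalize DuskinSimplex.obj σ k.castSucc = a
  generalize DuskinSimplex.obj σ k.succ = b
  intro key f
  cases a <;> cases b
  · exact absurd rfl key
  · exact ⟨rfl, rfl⟩
  · exact PEmpty.elim f
  · exact absurd rfl key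

lemma IsOfType.obj_eq_x {σ : (duskinNerve (Suspension D)) _⦋n⦌} {k : Fin n}
    (h : IsOfType σ k) {i : Fin (n + 1)} (hi : i ≤ k.castSucc) : DuskinSimplex.obj σ i = .x := by
  have f := DuskinSimplex.map σ hi
  rw [h.obj_castSucc_succ.1] at f
  revert f
  generalize DuskinSimplex.obj σ i = a
  intro f
  cases a
  · rfl
  · exact PEmpty.elim f

lemma IsOfType.obj_eq_y {σ : (duskinNerve (Suspension D)) _⦋n⦌} {k : Fin n}
    (h : IsOfType σ k) {i : Fin (n + 1)} (hi : k.succ ≤ i) : DuskinSimplex.obj σ i = .y := by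
  have f := DuskinSimplex.map σ hi
  rw [h.obj_castSucc_succ.2] at f
  revert f
  generalize DuskinSimplex.obj σ i = a
  intro f
  cases a
  · exact PEmpty.elim f
  · rfl

end typeK

/-- The vertex `i` of `[n]` that corresponds to the row `i ∈ [k]` of a matrix. -/
def rowVertex {n : ℕ} (k : Fin n) (i : Fin ((k : ℕ) + 1)) : Fin (n + 1) :=
  ⟨i, by have := i.isLt; have := k.isLt; omega⟩

/-- The vertex `k + 1 + j` of `[n]` that corresponds to the column `j ∈ [n-1-k]` of a matrix. -/
def colVertex {n : ℕ} (k : Fin n) (j : Fin (n - 1 - (k : ℕ) + 1)) : Fin (n + 1) :=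
  ⟨k + 1 + j, by have := j.isLt; have := k.isLt; omega⟩

section matrixOf

variable {n : ℕ} (k : Fin n)

lemma rowVertex_le (i : Fin ((k : ℕ) + 1)) : rowVertex k i ≤ k.castSucc :=
  Fin.mk_le_of_le_val (Nat.le_of_lt_succ i.isLt)

lemma le_colVertex (j : Fin (n - 1 - (k : ℕ) + 1)) : k.succ ≤ colVertex k j :=
  Fin.le_def.2 (by simp [colVertex])

lemma rowVertex_le_colVertex (i : Fin ((k : ℕ) + 1)) (j : Fin (n - 1 - (k : ℕ) + 1)) :
    rowVertex k i ≤ colVertex k j :=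
  (rowVertex_le k i).trans ((Fin.castSucc_le_succ k).trans (le_colVertex k j))

lemma rowVertex_mono {i i' : Fin ((k : ℕ) + 1)} (h : i ≤ i') : rowVertex k i ≤ rowVertex k i' :=
  Fin.le_def.2 (Fin.le_def.1 h)

lemma colVertex_mono {j j' : Fin (n - 1 - (k : ℕ) + 1)} (h : j ≤ j') :
    colVertex k j ≤ colVertex k j' :=
  Fin.le_def.2 (Nat.add_le_add_left (Fin.le_def.1 h) _)

variable {D : Type u} [Category.{v} D]

/-- The category `[k] × [n-1-k]ᵒᵖ`. -/
abbrev MatrixShape : Type := Fin ((k : ℕ) + 1) × (Fin (n - 1 - (k : ℕ) + 1))ᵒᵖ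

open Suspension in
/-- The `D`-valued matrix `M_σ : [k] × [n-1-k]ᵒᵖ ⥤ D` corresponding to an `n`-simplex `σ` of `N(Σ D)`
of type `k`. Its entry at `(i, j)` is the object of `D` given by the edge `(i, k+1+j)` of `σ`; the
vertical morphism `(i, j) ⟶ (i', j)` is the 2-cell of the face `(i, i', k+1+j)`, and the horizontal
morphism `(i, j) ⟶ (i, j')`, for `j' ≤ j`, is the 2-cell of the face `(i, k+1+j', k+1+j)`. -/
def matrixOf {k : Fin n} (σ : (duskinNerve (Suspension D)) _⦋n⦌) (hσ : IsOfType σ k) :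
    MatrixShape k ⥤ D where
  obj p := (homFunctor (hσ.obj_eq_x (rowVertex_le k p.1))
    (hσ.obj_eq_y (le_colVertex k p.2.unop))).obj
      (DuskinSimplex.map σ (rowVertex_le_colVertex k p.1 p.2.unop))
  map {p q} f :=
    cellLeft (hσ.obj_eq_x (rowVertex_le k p.1)) (hσ.obj_eq_x (rowVertex_le k q.1))
        (hσ.obj_eq_y (le_colVertex k p.2.unop))
        (DuskinSimplex.cell σ (rowVertex_mono k (leOfHom f.1))
          (rowVertex_le_colVertex k q.1 p.2.unop)) ≫
      cellRight (hσ.obj_eq_x (rowVertex_le k q.1)) (hσ.obj_eq_y (le_colVertex k q.2.unop))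
        (hσ.obj_eq_y (le_colVertex k p.2.unop))
        (DuskinSimplex.cell σ (rowVertex_le_colVertex k q.1 q.2.unop)
          (colVertex_mono k (leOfHom f.2.unop)))
  map_id p := by
    rw [cellLeft_id _ _ (DuskinSimplex.map_id σ _) _ (DuskinSimplex.cell_id_left σ _),
      cellRight_id _ _ (DuskinSimplex.map_id σ _) _ (DuskinSimplex.cell_id_right σ _),
      Category.id_comp]
  map_comp {p q r} f g := by
    rw [← cellLeft_comp _ (hσ.obj_eq_x (rowVertex_le k q.1)) _ _
        (DuskinSimplex.cell_assoc σ (rowVertex_mono k (leOfHom f.1))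
          (rowVertex_mono k (leOfHom g.1)) _),
      ← cellRight_comp _ _ (hσ.obj_eq_y (le_colVertex k q.2.unop)) _
        (DuskinSimplex.cell_assoc σ _ (colVertex_mono k (leOfHom g.2.unop))
          (colVertex_mono k (leOfHom f.2.unop)))]
    simp only [Category.assoc]
    congr 1
    simp only [← Category.assoc]
    congr 1
    exact cellLeft_cellRight _ _ _ _
      (DuskinSimplex.cell_assoc σ (rowVertex_mono k (leOfHom g.1))
        (rowVertex_le_colVertex k r.1 q.2.unop) (colVertex_mono k (leOfHom f.2.unop)))

end matrixOf

/-- `(a, b)` with `a < b` is a diagonal of the convex `(n+1)`-gon with cyclically numbered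
vertices `0, …, n`: the two vertices are not adjacent on the boundary. -/
def IsDiagonal {n : ℕ} (p : Fin (n + 1) × Fin (n + 1)) : Prop :=
  (p.1 : ℕ) + 2 ≤ p.2 ∧ ¬ (p.1 = 0 ∧ p.2 = Fin.last n)

/-- Two diagonals (with increasingly ordered endpoints) of a convex polygon cross in an interior
point. -/
def Crosses {n : ℕ} (p q : Fin (n + 1) × Fin (n + 1)) : Prop :=
  (p.1 < q.1 ∧ q.1 < p.2 ∧ p.2 < q.2) ∨ (q.1 < p.1 ∧ p.1 < q.2 ∧ q.2 < p.2)

/-- A triangulation of the convex `(n+1)`-gon, all of whose vertices are vertices of the polygon: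
a maximal set of pairwise non-crossing diagonals. -/
@[ext]
structure PolygonTriangulation (n : ℕ) where
  diagonals : Set (Fin (n + 1) × Fin (n + 1))
  isDiagonal : ∀ p ∈ diagonals, IsDiagonal p
  not_crosses : ∀ p ∈ diagonals, ∀ q ∈ diagonals, ¬ Crosses p q
  maximal : ∀ p, IsDiagonal p → (∀ q ∈ diagonals, ¬ Crosses p q) → p ∈ diagonals

namespace PolygonTriangulation

variable {n : ℕ} (T : PolygonTriangulation n)

/-- The edges of the triangulation: the sides of the polygon and the chosen diagonals. -/
def IsEdge (a b : Fin (n + 1)) : Prop :=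
  a < b ∧ (¬ IsDiagonal (a, b) ∨ (a, b) ∈ T.diagonals)

/-- The triangles of the triangulation, as sets of three vertices. -/
def triangles : Set (Finset (Fin (n + 1))) :=
  {t | ∃ a b c, T.IsEdge a b ∧ T.IsEdge b c ∧ T.IsEdge a c ∧ t = {a, b, c}}

/-- The simplicial subset `Δ[T]` of `Δ[n]` generated by the 2-faces corresponding to the triangles
of `T`. -/
def subcomplex : (Δ[n] : SSet.{u}).Subcomplex :=
  ⨆ t ∈ T.triangles, SSet.stdSimplex.face t

/-- No triangle of `T` has all its vertices in `{0, …, k}`, and none has all its vertices in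
`{k+1, …, n}`. -/
def IsAdmissible (k : Fin n) : Prop :=
  ∀ t ∈ T.triangles, ¬ (∀ a ∈ t, a ≤ k.castSucc) ∧ ¬ (∀ a ∈ t, k.succ ≤ a)

end PolygonTriangulation

section correspondence

variable {D : Type u} [Category.{v} D] {n : ℕ}

/-- A `σ`-labeled triangulation, for an `n`-simplex `σ` of type `k`: an admissible triangulation `T`
together with the composite `Δ[T] ↪ Δ[n] → N(Σ D)` of the inclusion and `σ`. -/
structure LabeledTriangulation (σ : (duskinNerve (Suspension D)) _⦋n⦌) (k : Fin n) where
  triangulation : PolygonTriangulation n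
  admissible : triangulation.IsAdmissible k
  label : (triangulation.subcomplex : SSet) ⟶ duskinNerve (Suspension D)
  label_eq : label = triangulation.subcomplex.ι ≫ SSet.yonedaEquiv.symm σ

/-- A shuffle `[k+l] → [k] × [l]ᵒᵖ` (used with `m = k + l`): a functor `[m] → [k] × [l]ᵒᵖ` which is
non-degenerate as an `m`-simplex of the nerve of `[k] × [l]ᵒᵖ`. -/
def IsShuffle {k l m : ℕ} (S : Fin (m + 1) ⥤ Fin (k + 1) × (Fin (l + 1))ᵒᵖ) : Prop :=
  (show (nerve (Fin (k + 1) × (Fin (l + 1))ᵒᵖ)) _⦋m⦌ from S) ∈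
    (nerve (Fin (k + 1) × (Fin (l + 1))ᵒᵖ)).nonDegenerate m

/-- A monotone path inside the matrix `M`: a shuffle `S : [n-1] → [k] × [n-1-k]ᵒᵖ` together with the
restriction of `M` along `S`. -/
structure MonotonePath {k : Fin n} (M : MatrixShape k ⥤ D) where
  shuffle : Fin (n - 1 + 1) ⥤ MatrixShape k
  isShuffle : IsShuffle shuffle
  path : Fin (n - 1 + 1) ⥤ D
  path_eq : path = shuffle ⋙ M

/-- Row index of the `t`-th entry visited by a monotone path. -/
def MonotonePath.row {k : Fin n} {M : MatrixShape k ⥤ D} (P : MonotonePath M)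
    (t : Fin (n - 1 + 1)) : Fin ((k : ℕ) + 1) :=
  (P.shuffle.obj t).1

/-- Column index of the `t`-th entry visited by a monotone path. -/
def MonotonePath.col {k : Fin n} {M : MatrixShape k ⥤ D} (P : MonotonePath M)
    (t : Fin (n - 1 + 1)) : Fin (n - 1 - (k : ℕ) + 1) :=
  (P.shuffle.obj t).2.unop

end correspondence

/-- The ordinate summation property characterizes shuffles. -/
lemma isShuffle_iff {k l m : ℕ} (hm : m = k + l)
    (S : Fin (m + 1) ⥤ Fin (k + 1) × (Fin (l + 1))ᵒᵖ) :
    IsShuffle S ↔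
      ∀ i : Fin (m + 1), ((S.obj i).1 : ℕ) + l = i + ((S.obj i).2.unop : ℕ) := by
  have : Quiver.IsThin (Fin (k + 1) × (Fin (l + 1))ᵒᵖ) := fun _ _ =>
    ⟨fun _ _ => Prod.ext (Subsingleton.elim _ _) (Quiver.Hom.unop_inj (Subsingleton.elim _ _))⟩
  have mono : ∀ {i j : Fin (m + 1)}, i ≤ j →
      ((S.obj i).1 : ℕ) ≤ (S.obj j).1 ∧ ((S.obj j).2.unop : ℕ) ≤ (S.obj i).2.unop :=
    fun h => ⟨Fin.le_def.1 (leOfHom (S.map (homOfLE h)).1),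
      Fin.le_def.1 (leOfHom (S.map (homOfLE h)).2.unop)⟩
  have bd : ∀ i : Fin (m + 1), ((S.obj i).1 : ℕ) ≤ k ∧ ((S.obj i).2.unop : ℕ) ≤ l :=
    fun i => ⟨Nat.le_of_lt_succ (S.obj i).1.isLt, Nat.le_of_lt_succ (S.obj i).2.unop.isLt⟩
  constructor
  · intro h
    have step : ∀ i : ℕ, ∀ hi : i + 1 < m + 1,
        ((S.obj ⟨i, by omega⟩).1 : ℕ) + (S.obj ⟨i + 1, hi⟩).2.unop <
          (S.obj ⟨i + 1, hi⟩).1 + ((S.obj ⟨i, by omega⟩).2.unop : ℕ) := by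
      intro i hi
      by_contra hlt
      have h1 := mono (i := ⟨i, by omega⟩) (j := ⟨i + 1, hi⟩) (Fin.le_def.2 (Nat.le_succ i))
      have e : S.obj ⟨i, by omega⟩ = S.obj ⟨i + 1, hi⟩ :=
        Prod.ext (Fin.ext (by omega)) (Opposite.unop_injective (Fin.ext (by omega)))
      obtain ⟨m, rfl⟩ : ∃ m', m = m' + 1 := ⟨m - 1, by omega⟩
      have hi' : i < m + 1 := by omega
      refine h ((SSet.degenerate_eq_iUnion_range_σ (nerve _)).ge (Set.mem_iUnion.2
        ⟨⟨i, hi'⟩, (nerve _).δ (Fin.castSucc ⟨i, hi'⟩) S, ?_⟩))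
      refine nerve.ext_of_isThin (funext fun j => ?_)
      change S.obj (Fin.succAbove _ (Fin.predAbove _ j)) = S.obj j
      by_cases hj : j = Fin.castSucc ⟨i, hi'⟩
      · subst hj
        refine Eq.trans (congrArg S.obj ?_) e.symm
        ext
        simp [Fin.predAbove, Fin.succAbove]
      · congr 1
        ext
        simp only [Fin.ext_iff, Fin.val_castSucc] at hj
        simp only [Fin.predAbove, Fin.succAbove, Fin.lt_def, Fin.val_castSucc]
        split_ifs <;> simp at * <;> omega
    have lower : ∀ i : ℕ, ∀ hi : i < m + 1,
        i + ((S.obj ⟨i, hi⟩).2.unop : ℕ) ≤ (S.obj ⟨i, hi⟩).1 + l := by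
      intro i
      induction i with
      | zero => intro hi; have := bd ⟨0, hi⟩; omega
      | succ i ih => intro hi; have := ih (by omega); have := step i hi; omega
    have upper : ∀ d i : ℕ, ∀ hi : i < m + 1, i + d = m →
        ((S.obj ⟨i, hi⟩).1 : ℕ) + l ≤ i + (S.obj ⟨i, hi⟩).2.unop := by
      intro d
      induction d with
      | zero => intro i hi hd; have := bd ⟨i, hi⟩; omega
      | succ d ih =>
        intro i hi hd
        have := ih (i + 1) (by omega) (by omega)
        have := step i (by omega)
        omega
    intro i
    exact le_antisymm (upper (m - i) i i.isLt (by omega)) (lower i i.isLt)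
  · rintro h ⟨m', hm', f, S', e⟩
    have inj : Function.Injective f.toOrderHom := by
      intro i j hij
      have hS : S.obj i = S.obj j := by
        rw [← e]
        change S'.obj (f.toOrderHom i) = S'.obj (f.toOrderHom j)
        rw [hij]
      have h1 := h i
      have h2 := h j
      rw [hS] at h1
      exact Fin.ext (by omega)
    have := Fintype.card_le_of_injective _ inj
    simp at this
    omega

/-! The label of a triangulation and the composite of a path are forced by the remaining data, so
the claim is purely combinatorial: admissible triangulations correspond to shuffles. Matrix position
`(i, j)` stands for the segment from `i` to `k+1+j`. Two such segments do not cross exactly when one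
is nested in the other, i.e. when their positions are comparable in `[k] × [n-1-k]ᵒᵖ`. The time `t`
of a position is `i - j + (n-1-k)`, and its segment has length `n - t`. An admissible triangulation
has exactly one such edge for each `t`. Uniqueness is `HasEntry.eq`. For existence
(`IsAdmissible.exists_hasEntry`), start from `(0, n)` and cross triangles one by one: admissibility
forces each to have a polygon side within one of the two blocks of vertices, so each crossing is a
unit step in the matrix. Conversely, the positions of a shuffle are pairwise comparable, hence give
non-crossing segments. This family is maximal because a shuffle visits every row, every column and
every time. -/

namespace PolygonTriangulation

/-! ### Edges of a triangulation and the triangles below them. -/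

variable {n : ℕ} (T : PolygonTriangulation n)

lemma isEdge_iff {a b : Fin (n + 1)} :
    T.IsEdge a b ↔ (a : ℕ) < b ∧
      ((b : ℕ) = a + 1 ∨ ((a : ℕ) = 0 ∧ (b : ℕ) = n) ∨ (a, b) ∈ T.diagonals) := by
  have key : a < b → (¬ IsDiagonal (a, b) ↔ (b : ℕ) = a + 1 ∨ ((a : ℕ) = 0 ∧ (b : ℕ) = n)) := by
    intro h
    rw [Fin.lt_def] at h
    simp only [IsDiagonal, Fin.ext_iff, Fin.val_zero, Fin.val_last]
    omega
  unfold IsEdge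
  constructor
  · rintro ⟨h, h'⟩
    rw [key h, or_assoc] at h'
    exact ⟨h, h'⟩
  · rintro ⟨h, h'⟩
    refine ⟨h, ?_⟩
    rw [key h, or_assoc]
    exact h'

variable {T}

/-- Edges of a triangulation do not cross. -/
lemma IsEdge.not_crosses {a b c d : Fin (n + 1)} (h : T.IsEdge a b) (h' : T.IsEdge c d) :
    ¬ ((a : ℕ) < c ∧ (c : ℕ) < b ∧ (b : ℕ) < d) := by
  rw [isEdge_iff] at h h'
  obtain ⟨-, h⟩ := h
  obtain ⟨-, h'⟩ := h'
  have := d.isLt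
  rcases h with h | h | h
  · omega
  · omega
  rcases h' with h' | h' | h'
  · omega
  · omega
  exact fun e => T.not_crosses _ h _ h' (Or.inl e)

/-- Maximality, rephrased for edges so that polygon sides need no separate treatment. -/
lemma isEdge_of_forall {a b : Fin (n + 1)} (h : (a : ℕ) < b)
    (H : ∀ c d, T.IsEdge c d → ¬ ((a : ℕ) < c ∧ (c : ℕ) < b ∧ (b : ℕ) < d) ∧
      ¬ ((c : ℕ) < a ∧ (a : ℕ) < d ∧ (d : ℕ) < b)) : T.IsEdge a b := by
  refine ⟨h, or_iff_not_imp_left.2 fun hd => T.maximal _ (not_not.1 hd) ?_⟩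
  rintro ⟨c, d⟩ hq hc
  have hcd : (c : ℕ) + 2 ≤ d := (T.isDiagonal _ hq).1
  have hlt : (c : ℕ) < d := by omega
  have := H c d (T.isEdge_iff.2 ⟨hlt, Or.inr (Or.inr hq)⟩)
  rcases hc with hc | hc
  · exact this.1 hc
  · exact this.2 hc

/-- An edge other than a side `(a, a + 1)` bounds a triangle on its inner side. -/
lemma IsEdge.exists_apex {a b : Fin (n + 1)} (h : T.IsEdge a b) (hab : (a : ℕ) + 2 ≤ b) :
    ∃ c, a < c ∧ c < b ∧ T.IsEdge a c ∧ T.IsEdge c b := by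
  classical
  have hb := b.isLt
  -- The apex is the farthest neighbour of `a` before `b`; `a + 1` shows that there is one.
  let s : Finset (Fin (n + 1)) := Finset.univ.filter fun c => c < b ∧ T.IsEdge a c
  have hs : s.Nonempty := by
    refine ⟨⟨a + 1, by omega⟩, Finset.mem_filter.2 ⟨Finset.mem_univ _, ?_, ?_⟩⟩
    · rw [Fin.lt_def]; simp only; omega
    · rw [isEdge_iff]; simp
  obtain ⟨c, hc, hmax⟩ := s.exists_max_image id hs
  obtain ⟨-, hcb, hac⟩ := Finset.mem_filter.1 hc
  refine ⟨c, hac.1, hcb, hac, isEdge_of_forall hcb fun p q hpq => ⟨?_, ?_⟩⟩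
  · have := h.not_crosses hpq
    have := Fin.lt_def.1 hac.1
    omega
  · rintro ⟨h1, h2, h3⟩
    have h4 := hpq.not_crosses h
    have h5 := hac.not_crosses hpq
    have h7 := Fin.lt_def.1 hac.1
    -- An edge starting before `a` would cross `(a, b)`, one starting after `a` would cross `(a,
    -- c)`; starting at `a`, it beats the choice of `c`.
    have h6 : p = a := Fin.ext (by omega)
    subst h6
    have := hmax q (Finset.mem_filter.2 ⟨Finset.mem_univ _, h3, hpq⟩)
    exact absurd (Fin.le_def.1 this) (not_le.2 h2)

/-! ### Consequences of admissibility. -/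

variable {k : Fin n}

/-- An edge of an admissible triangulation with both ends at most `k` is a side. -/
lemma IsAdmissible.eq_add_one_of_le (hT : T.IsAdmissible k) {a b : Fin (n + 1)}
    (h : T.IsEdge a b) (hb : (b : ℕ) ≤ k) : (b : ℕ) = a + 1 := by
  by_contra hne
  have hab := Fin.lt_def.1 h.1
  -- The apex lies between `a` and `b`, so the whole triangle would lie in `{0, …, k}`.
  obtain ⟨c, h1, h2, h3, h4⟩ := h.exists_apex (by omega)
  rw [Fin.lt_def] at h1 h2
  refine (hT {a, c, b} ⟨a, c, b, h3, h4, h, rfl⟩).1 ?_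
  simp only [Finset.mem_insert, Finset.mem_singleton, Fin.le_def, Fin.val_castSucc]
  rintro x (rfl | rfl | rfl) <;> omega

/-- An edge of an admissible triangulation with both ends greater than `k` is a side. -/
lemma IsAdmissible.eq_add_one_of_lt (hT : T.IsAdmissible k) {a b : Fin (n + 1)}
    (h : T.IsEdge a b) (ha : (k : ℕ) < a) : (b : ℕ) = a + 1 := by
  by_contra hne
  have hab := Fin.lt_def.1 h.1
  obtain ⟨c, h1, h2, h3, h4⟩ := h.exists_apex (by omega)
  rw [Fin.lt_def] at h1 h2
  refine (hT {a, c, b} ⟨a, c, b, h3, h4, h, rfl⟩).2 ?_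
  simp only [Finset.mem_insert, Finset.mem_singleton, Fin.le_def, Fin.val_succ]
  rintro x (rfl | rfl | rfl) <;> omega

/-- The diagonals of an admissible triangulation join `{0, …, k}` to `{k+1, …, n}`. -/
lemma IsAdmissible.diagonal_bounds (hT : T.IsAdmissible k) {a b : Fin (n + 1)}
    (h : (a, b) ∈ T.diagonals) : (a : ℕ) ≤ k ∧ (k : ℕ) < b := by
  have hd : (a : ℕ) + 2 ≤ b := (T.isDiagonal _ h).1
  have he : T.IsEdge a b := T.isEdge_iff.2 ⟨by omega, Or.inr (Or.inr h)⟩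
  constructor
  · by_contra hlt
    have := hT.eq_add_one_of_lt he (by omega)
    omega
  · by_contra hlt
    have := hT.eq_add_one_of_le he (by omega)
    omega

/-! ### From admissible triangulations to shuffles. -/

variable (T) in
/-- The position `p` of the matrix corresponds to an edge of the triangulation. -/
def HasEntry (p : MatrixShape k) : Prop :=
  T.IsEdge (rowVertex k p.1) (colVertex k p.2.unop)

/-- Row vertices precede all column vertices, so segments that are not nested must cross. -/
lemma HasEntry.nested {p q : MatrixShape k} (hp : T.HasEntry p) (hq : T.HasEntry q) :
    ((p.1 : ℕ) ≤ q.1 ∧ (q.2.unop : ℕ) ≤ p.2.unop) ∨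
      ((q.1 : ℕ) ≤ p.1 ∧ (p.2.unop : ℕ) ≤ q.2.unop) := by
  have h1 := IsEdge.not_crosses hp hq
  have h2 := IsEdge.not_crosses hq hp
  have := p.1.isLt
  have := q.1.isLt
  simp only [rowVertex, colVertex] at h1 h2
  omega

/-- The quantity `i - j` is strictly monotone on comparable positions. -/
lemma HasEntry.eq {p q : MatrixShape k} (hp : T.HasEntry p) (hq : T.HasEntry q)
    (h : (p.1 : ℕ) + (q.2.unop : ℕ) = q.1 + (p.2.unop : ℕ)) : p = q := by
  have := hp.nested hq
  exact Prod.ext (Fin.ext (by omega)) (Opposite.unop_injective (Fin.ext (by omega)))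

lemma IsAdmissible.exists_hasEntry (hT : T.IsAdmissible k) (t : ℕ) (ht : t ≤ n - 1) :
    ∃ p : MatrixShape k, T.HasEntry p ∧ (p.1 : ℕ) + (n - 1 - k) = t + (p.2.unop : ℕ) := by
  have hk := k.isLt
  induction t with
  | zero =>
    refine ⟨(⟨0, by omega⟩, op ⟨n - 1 - k, by omega⟩), ?_, by simp⟩
    have e : (k : ℕ) + 1 + (n - 1 - k) = n := by omega
    exact T.isEdge_iff.2 ⟨by simp only [rowVertex, colVertex]; omega, Or.inr (Or.inl ⟨rfl, e⟩)⟩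
  | succ t ih =>
    obtain ⟨⟨⟨i, hi⟩, ⟨⟨j, hj⟩⟩⟩, hp, e⟩ := ih (by omega)
    simp only at e
    -- The current edge has length `n - t ≥ 2`. Its apex is `i + 1` or the vertex just before its
    -- upper end, giving a vertical or a horizontal step.
    obtain ⟨c, h1, h2, h3, h4⟩ := IsEdge.exists_apex hp (by simp [rowVertex, colVertex]; omega)
    simp only [rowVertex, colVertex, Fin.lt_def] at h1 h2
    by_cases hc : (c : ℕ) ≤ k
    · have := hT.eq_add_one_of_le h3 hc
      simp only [rowVertex] at this
      have hi' : i + 1 < k + 1 := by omega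
      obtain rfl : c = rowVertex k ⟨i + 1, hi'⟩ := Fin.ext this
      exact ⟨(⟨i + 1, hi'⟩, op ⟨j, hj⟩), h4, by simp only; omega⟩
    · have := hT.eq_add_one_of_lt h4 (by omega)
      simp only [colVertex] at this
      have hj' : j - 1 < n - 1 - k + 1 := by omega
      obtain rfl : c = colVertex k ⟨j - 1, hj'⟩ := Fin.ext (by simp only [colVertex]; omega)
      exact ⟨(⟨i, hi⟩, op ⟨j - 1, hj'⟩), h3, by simp only; omega⟩

/-- The entry visited at time `t` by the shuffle of an admissible triangulation. -/
noncomputable def IsAdmissible.entry (hT : T.IsAdmissible k) (t : Fin (n - 1 + 1)) :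
    MatrixShape k :=
  (hT.exists_hasEntry t (Nat.le_of_lt_succ t.isLt)).choose

lemma IsAdmissible.hasEntry_entry (hT : T.IsAdmissible k) (t : Fin (n - 1 + 1)) :
    T.HasEntry (hT.entry t) :=
  (hT.exists_hasEntry t (Nat.le_of_lt_succ t.isLt)).choose_spec.1

lemma IsAdmissible.entry_add (hT : T.IsAdmissible k) (t : Fin (n - 1 + 1)) :
    ((hT.entry t).1 : ℕ) + (n - 1 - k) = t + ((hT.entry t).2.unop : ℕ) :=
  (hT.exists_hasEntry t (Nat.le_of_lt_succ t.isLt)).choose_spec.2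

lemma IsAdmissible.entry_eq (hT : T.IsAdmissible k) {t : Fin (n - 1 + 1)} {p : MatrixShape k}
    (hp : T.HasEntry p) (h : (p.1 : ℕ) + (n - 1 - k) = t + (p.2.unop : ℕ)) :
    hT.entry t = p :=
  (hT.hasEntry_entry t).eq hp (by have := hT.entry_add t; omega)

/-- The shuffle of an admissible triangulation. -/
noncomputable def IsAdmissible.shuffle (hT : T.IsAdmissible k) :
    Fin (n - 1 + 1) ⥤ MatrixShape k where
  obj := hT.entry
  map {s t} f := by
    have h : ((hT.entry s).1 : ℕ) ≤ (hT.entry t).1 ∧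
        ((hT.entry t).2.unop : ℕ) ≤ (hT.entry s).2.unop := by
      have := (hT.hasEntry_entry s).nested (hT.hasEntry_entry t)
      have := hT.entry_add s
      have := hT.entry_add t
      have := Fin.le_def.1 (leOfHom f)
      omega
    exact ⟨homOfLE (Fin.le_def.2 h.1), (homOfLE (Fin.le_def.2 h.2)).op⟩
  map_id _ := rfl
  map_comp _ _ := rfl

lemma IsAdmissible.isShuffle_shuffle (hT : T.IsAdmissible k) : IsShuffle hT.shuffle :=
  (isShuffle_iff (by have := k.isLt; omega) _).2 hT.entry_add

/-- The triangles of an admissible triangulation are cut out by consecutive entries of its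
shuffle. -/
lemma IsAdmissible.triangles_eq (hT : T.IsAdmissible k) :
    T.triangles = Set.range fun t : Fin (n - 1) =>
      ({rowVertex k (hT.entry t.castSucc).1, rowVertex k (hT.entry t.succ).1,
        colVertex k (hT.entry t.succ).2.unop, colVertex k (hT.entry t.castSucc).2.unop} :
        Finset (Fin (n + 1))) := by
  have hk := k.isLt
  apply Set.Subset.antisymm
  · rintro _ ⟨a, b, c, hab, hbc, hac, rfl⟩
    have hadm := hT _ ⟨a, b, c, hab, hbc, hac, rfl⟩
    have h1 := Fin.lt_def.1 hab.1
    have h2 := Fin.lt_def.1 hbc.1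
    have hc := c.isLt
    simp only [Finset.mem_insert, Finset.mem_singleton, Fin.le_def, Fin.val_castSucc,
      Fin.val_succ, forall_eq_or_imp, forall_eq] at hadm
    have ec : colVertex k ⟨c - (k + 1), by omega⟩ = c :=
      Fin.ext (by simp only [colVertex]; omega)
    have ea : rowVertex k ⟨a, by omega⟩ = a := rfl
    -- The longest edge `(a, c)` joins the two blocks; its length `c - a = n - t` determines the
    -- time. The entry at `t + 1` depends on the block of `b`.
    have e1 : hT.entry (Fin.castSucc ⟨a + (n - c), by omega⟩) =
        (⟨a, by omega⟩, op ⟨c - (k + 1), by omega⟩) :=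
      hT.entry_eq (by simpa only [HasEntry, ec, ea] using hac)
        (by simp only [Fin.val_castSucc]; omega)
    by_cases hb : (b : ℕ) ≤ k
    · have := hT.eq_add_one_of_le hab hb
      have eb : rowVertex k ⟨b, by omega⟩ = b := rfl
      have e2 : hT.entry (Fin.succ ⟨a + (n - c), by omega⟩) =
          (⟨b, by omega⟩, op ⟨c - (k + 1), by omega⟩) :=
        hT.entry_eq (by simpa only [HasEntry, ec, eb] using hbc)
          (by simp only [Fin.val_succ]; omega)
      refine ⟨⟨a + (n - c), by omega⟩, ?_⟩
      simp only [e1, e2, ea, eb, ec]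
      ext; simp
    · have := hT.eq_add_one_of_lt hbc (by omega)
      have eb : colVertex k ⟨b - (k + 1), by omega⟩ = b :=
        Fin.ext (by simp only [colVertex]; omega)
      have e2 : hT.entry (Fin.succ ⟨a + (n - c), by omega⟩) =
          (⟨a, by omega⟩, op ⟨b - (k + 1), by omega⟩) :=
        hT.entry_eq (by simpa only [HasEntry, ea, eb] using hab)
          (by simp only [Fin.val_succ]; omega)
      refine ⟨⟨a + (n - c), by omega⟩, ?_⟩
      simp only [e1, e2, ea, eb, ec]
      ext; simp
  · rintro _ ⟨t, rfl⟩
    have h1 := hT.hasEntry_entry t.castSucc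
    have h2 := hT.hasEntry_entry t.succ
    have e1 := hT.entry_add t.castSucc
    have e2 := hT.entry_add t.succ
    have hn := h1.nested h2
    dsimp only
    generalize hT.entry t.castSucc = p at *
    generalize hT.entry t.succ = q at *
    simp only [Fin.val_castSucc, Fin.val_succ] at e1 e2
    obtain ⟨i, ⟨j⟩⟩ := p
    obtain ⟨i', ⟨j'⟩⟩ := q
    dsimp only [HasEntry] at *
    -- Comparable positions at consecutive times differ by one in exactly one coordinate, which
    -- yields the polygon side of the triangle.
    by_cases hi : (i : ℕ) = i'
    · obtain rfl : i = i' := Fin.ext hi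
      refine ⟨_, _, _, h2, ?_, h1, by ext; simp⟩
      rw [isEdge_iff]
      simp only [colVertex]
      omega
    · obtain rfl : j = j' := Fin.ext (by omega)
      refine ⟨_, _, _, ?_, h2, h1, by ext; simp⟩
      rw [isEdge_iff]
      simp only [rowVertex]
      omega

end PolygonTriangulation

/-! ### From shuffles to admissible triangulations. -/

section ofShuffle

variable {n : ℕ} {k : Fin n} {S : Fin (n - 1 + 1) ⥤ MatrixShape k}

lemma IsShuffle.row_add (hS : IsShuffle S) (t : Fin (n - 1 + 1)) :
    ((S.obj t).1 : ℕ) + (n - 1 - k) = t + ((S.obj t).2.unop : ℕ) :=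
  (isShuffle_iff (by have := k.isLt; omega) S).1 hS t

lemma MatrixShape.functor_mono (S : Fin (n - 1 + 1) ⥤ MatrixShape k) {s t : Fin (n - 1 + 1)}
    (h : s ≤ t) :
    ((S.obj s).1 : ℕ) ≤ (S.obj t).1 ∧ ((S.obj t).2.unop : ℕ) ≤ (S.obj s).2.unop :=
  ⟨Fin.le_def.1 (leOfHom (S.map (homOfLE h)).1),
    Fin.le_def.1 (leOfHom (S.map (homOfLE h)).2.unop)⟩

/-- A shuffle visits every row. -/
lemma IsShuffle.exists_row_eq (hS : IsShuffle S) (i : ℕ) (hi : i ≤ k) :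
    ∃ t, ((S.obj t).1 : ℕ) = i := by
  have hk := k.isLt
  have hr := hS.row_add
  -- Discrete intermediate values: rows start at `0`, grow by at most one per step and end at `k`.
  have key : ∀ t : ℕ, ∀ ht : t < n - 1 + 1, ∀ i : ℕ, i ≤ (S.obj ⟨t, ht⟩).1 →
      ∃ t, ((S.obj t).1 : ℕ) = i := by
    intro t
    induction t with
    | zero =>
      intro ht i hi
      have := hr ⟨0, ht⟩
      have := (S.obj ⟨0, ht⟩).2.unop.isLt
      simp only at *
      exact ⟨⟨0, ht⟩, by omega⟩
    | succ t ih =>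
      intro ht i hi
      have h1 := hr ⟨t, by omega⟩
      have h2 := hr ⟨t + 1, ht⟩
      have h3 := MatrixShape.functor_mono S (s := ⟨t, by omega⟩) (t := ⟨t + 1, ht⟩)
        (Fin.le_def.2 (Nat.le_succ t))
      simp only at h1 h2
      rcases Nat.lt_or_ge ((S.obj ⟨t, by omega⟩).1 : ℕ) i with h | h
      · exact ⟨⟨t + 1, ht⟩, by omega⟩
      · exact ih _ _ h
  refine key (n - 1) (by omega) i ?_
  have := hr ⟨n - 1, by omega⟩
  have := (S.obj ⟨n - 1, by omega⟩).1.isLt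
  simp only at *
  omega

/-- A shuffle visits every column. -/
lemma IsShuffle.exists_col_eq (hS : IsShuffle S) (j : ℕ) (hj : j ≤ n - 1 - k) :
    ∃ t, ((S.obj t).2.unop : ℕ) = j := by
  have hk := k.isLt
  have hr := hS.row_add
  have key : ∀ t : ℕ, ∀ ht : t < n - 1 + 1, ∀ j : ℕ, j ≤ n - 1 - k →
      ((S.obj ⟨t, ht⟩).2.unop : ℕ) ≤ j → ∃ t, ((S.obj t).2.unop : ℕ) = j := by
    intro t
    induction t with
    | zero =>
      intro ht j hj hi
      have := hr ⟨0, ht⟩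
      simp only at *
      exact ⟨⟨0, ht⟩, by omega⟩
    | succ t ih =>
      intro ht j hj hi
      have h1 := hr ⟨t, by omega⟩
      have h2 := hr ⟨t + 1, ht⟩
      have h3 := MatrixShape.functor_mono S (s := ⟨t, by omega⟩) (t := ⟨t + 1, ht⟩)
        (Fin.le_def.2 (Nat.le_succ t))
      simp only at h1 h2
      rcases Nat.lt_or_ge j ((S.obj ⟨t, by omega⟩).2.unop : ℕ) with h | h
      · exact ⟨⟨t + 1, ht⟩, by omega⟩
      · exact ih _ _ hj h
  refine key (n - 1) (by omega) j hj ?_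
  have := hr ⟨n - 1, by omega⟩
  have := (S.obj ⟨n - 1, by omega⟩).1.isLt
  simp only at *
  omega

lemma isDiagonal_iff {p : Fin (n + 1) × Fin (n + 1)} :
    IsDiagonal p ↔ (p.1 : ℕ) + 2 ≤ p.2 ∧ ¬ ((p.1 : ℕ) = 0 ∧ (p.2 : ℕ) = n) := by
  simp only [IsDiagonal, Fin.ext_iff, Fin.val_zero, Fin.val_last]

/-- The triangulation of a shuffle. -/
def IsShuffle.triangulation (hS : IsShuffle S) : PolygonTriangulation n where
  -- The condition `IsDiagonal` discards the two extreme entries, the sides `(0, n)` and `(k, k+1)`.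
  diagonals := {p | IsDiagonal p ∧
    ∃ t, p = (rowVertex k (S.obj t).1, colVertex k (S.obj t).2.unop)}
  isDiagonal _ hp := hp.1
  not_crosses := by
    rintro _ ⟨-, s, rfl⟩ _ ⟨-, t, rfl⟩
    simp only [Crosses, rowVertex, colVertex, Fin.lt_def]
    rcases le_total s t with h | h
    · have := MatrixShape.functor_mono S h
      omega
    · have := MatrixShape.functor_mono S h
      omega
  maximal := by
    rintro ⟨a, b⟩ hd H
    refine ⟨hd, ?_⟩
    rw [isDiagonal_iff] at hd
    simp only at hd
    have hb := b.isLt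
    have hk := k.isLt
    have hr := hS.row_add
    have H' : ∀ t, IsDiagonal (rowVertex k (S.obj t).1, colVertex k (S.obj t).2.unop) →
        ¬ Crosses (a, b) (rowVertex k (S.obj t).1, colVertex k (S.obj t).2.unop) :=
      fun t ht => H _ ⟨ht, t, rfl⟩
    simp only [isDiagonal_iff, Crosses, Fin.lt_def, rowVertex, colVertex] at H'
    by_cases hbk : (b : ℕ) ≤ k
    -- A diagonal inside the first block is crossed by the entry in row `a + 1`; the second block is
    -- treated likewise with the column of vertex `a + 1`.
    · obtain ⟨t, ht⟩ := hS.exists_row_eq (a + 1) (by omega)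
      have := H' t
      omega
    by_cases hak : (k : ℕ) < a
    · obtain ⟨t, ht⟩ := hS.exists_col_eq (a + 1 - (k + 1)) (by omega)
      have := H' t
      have := (S.obj t).1.isLt
      omega
    -- At the time of `(a, b)`, the entry either equals `(a, b)` or has both ends shifted in the
    -- same direction, and then crosses it.
    have hlt : (a : ℕ) + (n - b) < n - 1 + 1 := by omega
    have h1 := H' ⟨_, hlt⟩
    have h2 := hr ⟨_, hlt⟩
    have h3 := (S.obj ⟨_, hlt⟩).1.isLt
    have h4 := (S.obj ⟨_, hlt⟩).2.unop.isLt
    refine ⟨⟨_, hlt⟩, Prod.ext (Fin.ext ?_) (Fin.ext ?_)⟩ <;>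
      simp only [rowVertex, colVertex] at * <;> omega

/-- The longest edge of a triangle is `(0, n)` or an entry of the shuffle, so it joins the two
blocks. -/
lemma IsShuffle.isAdmissible_triangulation (hS : IsShuffle S) :
    hS.triangulation.IsAdmissible k := by
  have hk := k.isLt
  rintro _ ⟨a, b, c, hab, hbc, hac, rfl⟩
  have h1 := Fin.lt_def.1 hab.1
  have h2 := Fin.lt_def.1 hbc.1
  have key : (a : ℕ) ≤ k ∧ (k : ℕ) < c := by
    rcases (hS.triangulation.isEdge_iff.1 hac).2 with h | h | ⟨-, t, h⟩
    · omega
    · omega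
    · obtain ⟨rfl, rfl⟩ := Prod.ext_iff.1 h
      have := (S.obj t).1.isLt
      simp only [rowVertex, colVertex]
      omega
  simp only [Finset.mem_insert, Finset.mem_singleton, Fin.le_def, Fin.val_castSucc,
    Fin.val_succ, forall_eq_or_imp, forall_eq]
  omega

lemma IsShuffle.hasEntry_triangulation (hS : IsShuffle S) (t : Fin (n - 1 + 1)) :
    hS.triangulation.HasEntry (S.obj t) := by
  have := (S.obj t).1.isLt
  refine ⟨?_, or_iff_not_imp_left.2 fun h => ⟨not_not.1 h, t, rfl⟩⟩
  simp only [rowVertex, colVertex, Fin.lt_def]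
  omega

lemma MatrixShape.functor_ext {S S' : Fin (n - 1 + 1) ⥤ MatrixShape k}
    (h : ∀ t, S.obj t = S'.obj t) : S = S' :=
  CategoryTheory.Functor.ext h fun _ _ _ =>
    Prod.ext (Subsingleton.elim _ _) (Quiver.Hom.unop_inj (Subsingleton.elim _ _))

lemma IsShuffle.shuffle_triangulation (hS : IsShuffle S) :
    hS.isAdmissible_triangulation.shuffle = S :=
  MatrixShape.functor_ext fun t =>
    hS.isAdmissible_triangulation.entry_eq (hS.hasEntry_triangulation t) (hS.row_add t)

/-- Every diagonal joins the two blocks, so it is the unique entry at the time given by its length.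
-/
lemma PolygonTriangulation.IsAdmissible.triangulation_shuffle {T : PolygonTriangulation n}
    (hT : T.IsAdmissible k) : hT.isShuffle_shuffle.triangulation = T := by
  have hk := k.isLt
  ext ⟨a, b⟩
  constructor
  · rintro ⟨hd, t, h⟩
    have := (hT.hasEntry_entry t).2
    rw [h] at hd ⊢
    exact this.resolve_left (not_not.2 hd)
  · intro h
    have hd := T.isDiagonal _ h
    obtain ⟨h1, h2⟩ := hT.diagonal_bounds h
    have hb := b.isLt
    have ha : rowVertex k ⟨a, by omega⟩ = a := rfl
    have eb : colVertex k ⟨b - (k + 1), by omega⟩ = b :=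
      Fin.ext (by simp only [colVertex]; omega)
    refine ⟨hd, ⟨a + (n - b), by omega⟩, ?_⟩
    have e : hT.entry ⟨a + (n - b), by omega⟩ =
        (⟨a, by omega⟩, op ⟨b - (k + 1), by omega⟩) := by
      refine hT.entry_eq ?_ (by simp only; omega)
      rw [PolygonTriangulation.HasEntry]
      simp only [ha, eb]
      exact T.isEdge_iff.2 ⟨by omega, Or.inr (Or.inr h)⟩
    change _ = (rowVertex k (hT.entry _).1, colVertex k (hT.entry _).2.unop)
    rw [e, eb, ha]

end ofShuffle

/-! ### Assembling the bijection. -/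

section correspondence

variable {D : Type u} [Category.{v} D] {n : ℕ} {k : Fin n}

lemma LabeledTriangulation.ext_triangulation {σ : (duskinNerve (Suspension D)) _⦋n⦌}
    {T T' : LabeledTriangulation σ k} (h : T.triangulation = T'.triangulation) : T = T' := by
  obtain ⟨T, _, _, rfl⟩ := T
  obtain ⟨T', _, _, rfl⟩ := T'
  obtain rfl : T = T' := h
  rfl

lemma MonotonePath.ext_shuffle {M : MatrixShape k ⥤ D} {P P' : MonotonePath M}
    (h : P.shuffle = P'.shuffle) : P = P' := by
  obtain ⟨S, _, _, rfl⟩ := P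
  obtain ⟨S', _, _, rfl⟩ := P'
  obtain rfl : S = S' := h
  rfl

/-- The bijection between `σ`-labeled triangulations and monotone paths inside a matrix. -/
noncomputable def labeledTriangulationEquiv (σ : (duskinNerve (Suspension D)) _⦋n⦌)
    (M : MatrixShape k ⥤ D) : LabeledTriangulation σ k ≃ MonotonePath M where
  toFun T := ⟨T.admissible.shuffle, T.admissible.isShuffle_shuffle, _, rfl⟩
  invFun P := ⟨P.isShuffle.triangulation, P.isShuffle.isAdmissible_triangulation, _, rfl⟩
  left_inv T := LabeledTriangulation.ext_triangulation T.admissible.triangulation_shuffle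
  right_inv P := MonotonePath.ext_shuffle P.isShuffle.shuffle_triangulation

end correspondence

theorem mainTheorem6 {D : Type u} [Category.{v} D] (n : ℕ) (hn : 2 ≤ n) (k : Fin n)
    (σ : (duskinNerve (Suspension D)) _⦋n⦌) (hσ : IsOfType σ k) :
    ∃ e : LabeledTriangulation σ k ≃ MonotonePath (matrixOf σ hσ),
      ∀ T : LabeledTriangulation σ k,
        T.triangulation.triangles = Set.range fun t : Fin (n - 1) =>
          ({rowVertex k ((e T).row t.castSucc), rowVertex k ((e T).row t.succ),
            colVertex k ((e T).col t.succ), colVertex k ((e T).col t.castSucc)} :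
            Finset (Fin (n + 1))) :=
  ⟨labeledTriangulationEquiv σ (matrixOf σ hσ), fun T => T.admissible.triangles_eq⟩
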